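/- Let $\mathcal M=(S,A,T,R,\beta)$ be a finite Markov decision process with available action sets $A(s)\subseteq A$, transition probabilities $T(s'\mid s,a)$ and initial distribution $\beta$. *Components.* A strongly connected component (SCC) of a digraph on $S$ is a maximal set of vertices any two of which are joined by directed paths in both directions; it is closed if no edge leaves it. A terminal strongly connected component (TSCC) is a closed SCC that is reachable from some state $s$ with $\beta_s>0$. The TSCCs of $\mathcal M$ are those of the digraph with an edge $s\to s'$ whenever $T(s'\mid s,a)>0$ for some $a\in A(s)$; call them $r_1(\mathcal M),\dots,r_m(\mathcal M)$, let $r(\mathcal M)$ be their union and $\bar r(\mathcal M)=S\setminus r(\mathcal M)$. A stationary policy $\pi$ assigns to each $s$ a probability distribution $\pi(\cdot\mid s)$ on $A(s)$; it induces the Markov chain $\mathcal M_\pi$ with transition probabilities $T_\pi(s'\mid s)=\sum_{a\in A(s)}T(s'\mid s,a)\pi(a\mid s)$ and initial distribution $\beta$. The TSCCs of $\mathcal M_\pi$ are those of the digraph with an edge $s\to s'$ whenever $T_\pi(s'\mid s)>0$ (so they are its recurrent classes that are reachable from $\beta$), and $r(\mathcal M_\pi)$ is their union. *Class-preserving up to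 unichain (CPU).* A stationary policy $\pi$ is CPU if $r(\mathcal M_\pi)\subseteq r(\mathcal M)$ and, for every $k\in\{1,\dots,m\}$, the set $r_k(\mathcal M)$ is reachable and unichain in $\mathcal M_\pi$: it contains exactly one TSCC of $\mathcal M_\pi$, and exactly one closed communicating class of $\mathcal M_\pi$ (all its other states being transient in $\mathcal M_\pi$). *The set $Q_0$.* It consists of all $(x,y)=\big((x_{sa}),(y_{sa})\big)_{s\in S,\,a\in A(s)}$ with $x_{sa}\in[0,1]$, $y_{sa}\ge 0$ and $$\sum_{s\in S}\sum_{a\in A(s)}x_{sa}T(s'\mid s,a)=\sum_{a\in A(s')}x_{s'a}\quad\forall s'\in S,$$ $$\sum_{s\in S}\sum_{a\in A(s)}y_{sa}T(s'\mid s,a)=\sum_{a\in A(s')}(x_{s'a}+y_{s'a})-\beta_{s'}\quad\forall s'\in S,$$ $$\sum_{f\in\bar r(\mathcal M)}\sum_{a\in A(f)}x_{fa}=0 .$$ *Derived policy.* Put $x_s=\sum_{a\in A(s)}x_{sa}$ and $y_s=\sum_{a\in A(s)}y_{sa}$. A policy $\pi=\pi(x,y)$ derived from $(x,y)$ is a stationary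 policy with $\pi(a\mid s)=x_{sa}/x_s$ if $x_s>0$, $\pi(a\mid s)=y_{sa}/y_s$ if $x_s=0<y_s$ (for $a\in A(s)$), and $\pi(\cdot\mid s)$ arbitrary otherwise. **Lemma.** Let $(x,y)\in Q_0$ and let $\pi=\pi(x,y)$ be a policy derived from $(x,y)$. If $\pi$ is CPU, then the steady-state distribution (occupation measure) of $\pi$ exists and equals $x$: for all $s\in S$ and $a\in A(s)$, $$\mathrm{Pr}^\infty_\pi(s,a):=\lim_{n\to\infty}\frac1n\sum_{t=1}^n\Pr(S_t=s,A_t=a\mid\beta,\pi)=x_{sa}.$$ -/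

import Mathlib

open Filter Topology

noncomputable section

namespace SteadyState

/-! ### Strongly connected components of a digraph -/

/-- A strongly connected component of the digraph `E`: a maximal set of vertices any two of which
are joined by directed paths in both directions. -/
def IsSCC {S : Type*} (E : S → S → Prop) (C : Set S) : Prop :=
  Maximal (fun D : Set S => ∀ s ∈ D, ∀ s' ∈ D, Relation.ReflTransGen E s s') C

/-- A strongly connected component without outgoing edges. For the transition graph of a finite
Markov chain these are the closed communicating classes, i.e. the recurrent classes, whether or not
the chain can reach them from its initial distribution. -/
def IsClosedClass {S : Type*} (E : S → S → Prop) (C : Set S) : Prop :=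
  IsSCC E C ∧ ∀ s ∈ C, ∀ s', E s s' → s' ∈ C

/-- A terminal strongly connected component (TSCC) of the digraph `E` with initial distribution
`β`: a strongly connected component without outgoing edges that is reachable from some state of
positive initial probability. -/
def IsTSCC {S : Type*} (E : S → S → Prop) (β : S → ℝ) (C : Set S) : Prop :=
  IsClosedClass E C ∧ ∃ s₀, 0 < β s₀ ∧ ∃ s ∈ C, Relation.ReflTransGen E s₀ s

/-- The union of all TSCCs. -/
def tsccUnion {S : Type*} (E : S → S → Prop) (β : S → ℝ) : Set S :=
  {s | ∃ C, IsTSCC E β C ∧ s ∈ C}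

/-! ### Markov decision processes -/

/-- A finite Markov decision process. `avail s` is the set of actions available in `s`, and
`T s a s'` is the probability of moving from `s` to `s'` under action `a`; its values at
unavailable actions play no role. -/
structure MDP (S A : Type*) [Fintype S] where
  avail : S → Finset A
  T : S → A → S → ℝ
  R : S → A → S → ℝ
  β : S → ℝ
  T_nonneg : ∀ s, ∀ a ∈ avail s, ∀ s', 0 ≤ T s a s'
  T_sum : ∀ s, ∀ a ∈ avail s, ∑ s', T s a s' = 1
  β_nonneg : ∀ s, 0 ≤ β s
  β_sum : ∑ s, β s = 1

variable {S A : Type*} [Fintype S]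

/-- A stationary policy: `prob s a` is the probability `π(a|s)` of playing `a` in `s`. -/
structure Policy (M : MDP S A) where
  prob : S → A → ℝ
  nonneg : ∀ s a, 0 ≤ prob s a
  eq_zero : ∀ s, ∀ a ∉ M.avail s, prob s a = 0
  sum_eq_one : ∀ s, ∑ a ∈ M.avail s, prob s a = 1

namespace MDP

/-- Edges of the transition graph of the MDP. -/
def Edge (M : MDP S A) (s s' : S) : Prop :=
  ∃ a ∈ M.avail s, 0 < M.T s a s'

/-- The TSCCs of the MDP. -/
def IsTSCC (M : MDP S A) (C : Set S) : Prop :=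
  SteadyState.IsTSCC M.Edge M.β C

/-- The union of the TSCCs of the MDP. -/
def recurrentSet (M : MDP S A) : Set S :=
  tsccUnion M.Edge M.β

open Classical in
/-- The constraint set `Q₀`. -/
structure Feasible (M : MDP S A) (x y : S → A → ℝ) : Prop where
  stationary : ∀ s', ∑ s, ∑ a ∈ M.avail s, x s a * M.T s a s' = ∑ a ∈ M.avail s', x s' a
  balance : ∀ s', ∑ s, ∑ a ∈ M.avail s, y s a * M.T s a s' =
    ∑ a ∈ M.avail s', (x s' a + y s' a) - M.β s'
  transient : ∑ f with f ∉ M.recurrentSet, ∑ a ∈ M.avail f, x f a = 0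
  x_nonneg : ∀ s, ∀ a ∈ M.avail s, 0 ≤ x s a
  x_le_one : ∀ s, ∀ a ∈ M.avail s, x s a ≤ 1
  y_nonneg : ∀ s, ∀ a ∈ M.avail s, 0 ≤ y s a

end MDP

namespace Policy

variable {M : MDP S A}

/-- The transition function `T_π(s'|s)` of the Markov chain induced by the policy. -/
def trans (π : Policy M) (s s' : S) : ℝ :=
  ∑ a ∈ M.avail s, M.T s a s' * π.prob s a

/-- Edges of the transition graph of the induced Markov chain. -/
def Edge (π : Policy M) (s s' : S) : Prop :=
  0 < π.trans s s'

/-- The recurrent classes (closed communicating classes) of the induced Markov chain. -/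
def IsRecurrentClass (π : Policy M) (D : Set S) : Prop :=
  IsClosedClass π.Edge D

/-- The TSCCs of the induced Markov chain, i.e. its reachable recurrent classes. -/
def IsTSCC (π : Policy M) (D : Set S) : Prop :=
  SteadyState.IsTSCC π.Edge M.β D

/-- The union of the TSCCs of the induced Markov chain. -/
def recurrentSet (π : Policy M) : Set S :=
  tsccUnion π.Edge M.β

/-- The policy is class-preserving up to unichain: the TSCCs of the induced chain lie in those of
the MDP, each TSCC of the MDP contains a unique TSCC of the induced chain, and each TSCC of the MDP
is unichain in the induced chain, i.e. contains a single closed communicating class of it. -/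
structure IsCPU (π : Policy M) : Prop where
  recurrentSet_subset : π.recurrentSet ⊆ M.recurrentSet
  existsUnique_tscc : ∀ C, M.IsTSCC C → ∃! D, π.IsTSCC D ∧ D ⊆ C
  unichain : ∀ C, M.IsTSCC C → ∃! D, π.IsRecurrentClass D ∧ D ⊆ C

/-- `π` is a policy `π(x,y)` derived from `(x,y)`; it is arbitrary in the states `s` in which
neither `x_s = ∑ a, x s a` nor `y_s = ∑ a, y s a` is positive. -/
structure IsDerivedFrom (π : Policy M) (x y : S → A → ℝ) : Prop where
  of_x : ∀ s, 0 < ∑ a ∈ M.avail s, x s a →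
    ∀ a ∈ M.avail s, π.prob s a = x s a / ∑ b ∈ M.avail s, x s b
  of_y : ∀ s, ¬ 0 < ∑ a ∈ M.avail s, x s a → 0 < ∑ a ∈ M.avail s, y s a →
    ∀ a ∈ M.avail s, π.prob s a = y s a / ∑ b ∈ M.avail s, y s b

/-- The probability of the state-action trajectory `h = ((s₀, a₀), …, (s_t, a_t))` when `s₀` is
drawn from `β`, each `a_i` from `π(·|s_i)` and each `s_{i+1}` from `T(·|s_i, a_i)`. -/
def trajProb (π : Policy M) (t : ℕ) (h : Fin (t + 1) → S × A) : ℝ :=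
  M.β (h 0).1 * (∏ i : Fin (t + 1), π.prob (h i).1 (h i).2) *
    ∏ i : Fin t, M.T (h i.castSucc).1 (h i.castSucc).2 (h i.succ).1

open Classical in
/-- `Pr(S_t = s, A_t = a | β, π)`: the total probability of the trajectories up to time `t` that
end in `(s, a)`. -/
def stateActionProb [Fintype A] (π : Policy M) (t : ℕ) (s : S) (a : A) : ℝ :=
  ∑ h : Fin (t + 1) → S × A with h (Fin.last t) = (s, a), π.trajProb t h

/-- `μ` is the steady-state distribution (occupation measure) of the policy: for every state `s`
and available action `a`, the limit of `(1/n) ∑_{t=1}^n Pr(S_t = s, A_t = a | β, π)` exists and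
equals `μ s a`. -/
def HasSteadyStateDistribution [Fintype A] (π : Policy M) (μ : S → A → ℝ) : Prop :=
  ∀ s, ∀ a ∈ M.avail s,
    Tendsto (fun n : ℕ => (1 / (n : ℝ)) * ∑ t ∈ Finset.Icc 1 n, π.stateActionProb t s a)
      atTop (𝓝 (μ s a))

end Policy

end SteadyState

end

namespace SteadyState

open Finset

/-! ### Closed classes of a finite digraph -/

/-! Let `P` be the chain of `π`, `x_s` and `y_s` the state totals, and `R` the union of the TSCCs of
the MDP. Feasibility makes `x_s` a probability vector, stationary for `P` and supported on `R`.
Outside `R` the policy follows `y`, and the balance equations make `y_s` an upper bound for the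
expected number of visits (`sum_range_marginal_le`), so those states have frequency zero.

For a TSCC `C`, the mass in `C` at any time is the initial mass plus past inflow, hence at most the
initial mass plus the `y`-inflow, which balance identifies with `x(C)` (`sum_marginal_closed_le`,
`sum_x_closed`). The same holds for `R \ C`. Both bounds must be attained in the limit, since the
total mass is one.

Every cluster point of the Cesàro averages is stationary and has these masses. On a unichain set a
stationary vector is determined by its mass (`eq_zero_of_stationary_of_unichain`), so the cluster
point is `x`, and compactness gives convergence. -/

/-- A nonempty set of vertices without outgoing edges contains a closed class. -/
theorem exists_isClosedClass_subset {S : Type*} [Finite S] {E : S → S → Prop} {D : Set S}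
    (hne : D.Nonempty) (hD : ∀ s ∈ D, ∀ s', E s s' → s' ∈ D) :
    ∃ C, IsClosedClass E C ∧ C.Nonempty ∧ C ⊆ D := by
  let reach : S → Set S := fun s => {t | Relation.ReflTransGen E s t}
  -- With a reachable set of least cardinality, every state reachable from `s` has the same
  -- reachable set and so leads back to `s`.
  obtain ⟨s, hsD, hmin⟩ := Set.exists_min_image D (fun s => (reach s).ncard) D.toFinite hne
  have hsub : reach s ⊆ D := by
    intro t ht
    induction ht with
    | refl => exact hsD
    | tail _ h ih => exact hD _ ih _ h
  have hback : ∀ t ∈ reach s, Relation.ReflTransGen E t s := by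
    intro t ht
    have hts : reach t ⊆ reach s := fun u hu => Relation.ReflTransGen.trans ht hu
    have heq : reach t = reach s := Set.eq_of_subset_of_ncard_le hts (hmin t (hsub ht))
    have : s ∈ reach t := by
      rw [heq]
      exact Relation.ReflTransGen.refl
    exact this
  refine ⟨reach s, ⟨⟨fun t ht u hu => (hback t ht).trans hu, ?_⟩, ?_⟩,
    ⟨s, Relation.ReflTransGen.refl⟩, hsub⟩
  · intro D' hD' hle u hu
    exact hD' s (hle Relation.ReflTransGen.refl) u hu
  · intro t ht u htu
    exact Relation.ReflTransGen.tail ht htu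

theorem mem_of_reflTransGen {S : Type*} {E : S → S → Prop} {C : Set S}
    (hC : ∀ s ∈ C, ∀ s', E s s' → s' ∈ C) {s t : S} (hs : s ∈ C)
    (h : Relation.ReflTransGen E s t) : t ∈ C := by
  induction h with
  | refl => exact hs
  | tail _ h ih => exact hC _ ih _ h

/-- No edge leads from one TSCC to another one. -/
theorem tsccUnion_diff_closed {S : Type*} {E : S → S → Prop} {β : S → ℝ} {C : Set S}
    (hC : IsTSCC E β C) {s s' : S} (hs : s ∈ tsccUnion E β) (hsC : s ∉ C) (h : E s s') :
    s' ∈ tsccUnion E β ∧ s' ∉ C := by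
  obtain ⟨C', hC', hsC'⟩ := hs
  have hs' : s' ∈ C' := hC'.1.2 s hsC' s' h
  exact ⟨⟨C', hC', hs'⟩, fun hmem =>
    hsC (mem_of_reflTransGen hC.1.2 hmem (hC'.1.1.prop s' hs' s hsC'))⟩

/-! ### Stationary vectors of stochastic matrices -/

section Stochastic

variable {S : Type*} [Fintype S] {P : S → S → ℝ}

/-- Positive parts can only grow entrywise under `P`, but stochastic rows preserve the total, so
every inequality is an equality. -/
theorem posPart_stationary (hP : ∀ s s', 0 ≤ P s s') (hP1 : ∀ s, ∑ s', P s s' = 1) {d : S → ℝ}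
    (hd : ∀ s', ∑ s, d s * P s s' = d s') (s' : S) :
    ∑ s, max (d s) 0 * P s s' = max (d s') 0 := by
  have hle : ∀ s' ∈ (univ : Finset S), max (d s') 0 ≤ ∑ s, max (d s) 0 * P s s' := by
    intro s' _
    refine max_le ?_ (sum_nonneg fun s _ => mul_nonneg (le_max_right _ _) (hP s s'))
    rw [← hd s']
    exact sum_le_sum fun s _ => mul_le_mul_of_nonneg_right (le_max_left _ _) (hP s s')
  have hsum : ∑ s', max (d s') 0 = ∑ s', ∑ s, max (d s) 0 * P s s' := by
    rw [sum_comm]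
    exact sum_congr rfl fun s _ => by rw [← mul_sum, hP1, mul_one]
  exact ((sum_eq_sum_iff_of_le hle).1 hsum s' (mem_univ _)).symm

/-- The set where a stationary vector is positive has no outgoing transitions. -/
theorem pos_of_stationary (hP : ∀ s s', 0 ≤ P s s') (hP1 : ∀ s, ∑ s', P s s' = 1) {d : S → ℝ}
    (hd : ∀ s', ∑ s, d s * P s s' = d s') {s s' : S} (hs : 0 < d s) (h : 0 < P s s') :
    0 < d s' := by
  have h1 : 0 < max (d s') 0 := by
    rw [← posPart_stationary hP hP1 hd s']
    refine sum_pos' (fun t _ => mul_nonneg (le_max_right _ _) (hP t s')) ⟨s, mem_univ _, ?_⟩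
    exact mul_pos (lt_max_of_lt_left hs) h
  simpa using h1

/-- A stationary vector of total mass zero on a unichain closed set is nonpositive there. -/
theorem nonpos_of_stationary_of_unichain (hP : ∀ s s', 0 ≤ P s s')
    (hP1 : ∀ s, ∑ s', P s s' = 1) {d : S → ℝ} (hd : ∀ s', ∑ s, d s * P s s' = d s')
    {C : Finset S} (hC : ∀ s ∈ C, ∀ s', 0 < P s s' → s' ∈ C)
    (huni : ∃! D, IsClosedClass (fun s s' => 0 < P s s') D ∧ D ⊆ (C : Set S))
    (h0 : ∑ s ∈ C, d s = 0) {s : S} (hs : s ∈ C) : d s ≤ 0 := by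
  by_contra! hpos
  -- Total mass zero forces a negative entry as well. The positive and negative supports in `C` are
  -- both closed, so they contain two disjoint closed classes.
  obtain ⟨t, htC, ht⟩ : ∃ t ∈ C, d t < 0 := by
    by_contra! hall
    exact hpos.ne' ((sum_eq_zero_iff_of_nonneg hall).1 h0 s hs)
  have hd' : ∀ s', ∑ s, -d s * P s s' = -d s' := fun s' => by
    simp only [neg_mul, sum_neg_distrib, hd s']
  obtain ⟨D₁, hD₁, ⟨u, hu⟩, hsub₁⟩ := exists_isClosedClass_subset (E := fun s s' => 0 < P s s')
    (D := {s | s ∈ C ∧ 0 < d s}) ⟨s, hs, hpos⟩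
    fun u hu v huv => ⟨hC u hu.1 v huv, pos_of_stationary hP hP1 hd hu.2 huv⟩
  obtain ⟨D₂, hD₂, -, hsub₂⟩ := exists_isClosedClass_subset (E := fun s s' => 0 < P s s')
    (D := {s | s ∈ C ∧ 0 < -d s}) ⟨t, htC, neg_pos.2 ht⟩
    fun u hu v huv => ⟨hC u hu.1 v huv, pos_of_stationary hP hP1 hd' hu.2 huv⟩
  have heq : D₁ = D₂ := huni.unique ⟨hD₁, fun v hv => (hsub₁ hv).1⟩
    ⟨hD₂, fun v hv => (hsub₂ hv).1⟩
  have h1 : 0 < d u := (hsub₁ hu).2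
  have h2 : 0 < -d u := (hsub₂ (heq ▸ hu)).2
  linarith

theorem eq_zero_of_stationary_of_unichain (hP : ∀ s s', 0 ≤ P s s')
    (hP1 : ∀ s, ∑ s', P s s' = 1) {d : S → ℝ} (hd : ∀ s', ∑ s, d s * P s s' = d s')
    {C : Finset S} (hC : ∀ s ∈ C, ∀ s', 0 < P s s' → s' ∈ C)
    (huni : ∃! D, IsClosedClass (fun s s' => 0 < P s s') D ∧ D ⊆ (C : Set S))
    (h0 : ∑ s ∈ C, d s = 0) {s : S} (hs : s ∈ C) : d s = 0 := by
  refine le_antisymm (nonpos_of_stationary_of_unichain hP hP1 hd hC huni h0 hs) ?_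
  have := nonpos_of_stationary_of_unichain (d := fun s => -d s) hP hP1
    (fun s' => by simp only [neg_mul, sum_neg_distrib, hd s']) hC huni
    (by simp [h0]) hs
  linarith

/-! ### Marginals of a Markov chain -/

/-- The distribution at time `t` of the chain with initial distribution `β`. -/
def marginal (P : S → S → ℝ) (β : S → ℝ) : ℕ → S → ℝ
  | 0 => β
  | t + 1 => fun s' => ∑ s, marginal P β t s * P s s'

variable {β : S → ℝ}

theorem marginal_nonneg (hP : ∀ s s', 0 ≤ P s s') (hβ : ∀ s, 0 ≤ β s) (t : ℕ) (s : S) :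
    0 ≤ marginal P β t s := by
  induction t generalizing s with
  | zero => exact hβ s
  | succ t ih => exact sum_nonneg fun u _ => mul_nonneg (ih u) (hP u s)

theorem sum_marginal (hP1 : ∀ s, ∑ s', P s s' = 1) (hβ1 : ∑ s, β s = 1) (t : ℕ) :
    ∑ s, marginal P β t s = 1 := by
  induction t with
  | zero => exact hβ1
  | succ t ih =>
    simp only [marginal]
    rw [sum_comm, ← ih]
    exact sum_congr rfl fun s _ => by rw [← mul_sum, hP1, mul_one]

theorem marginal_le_one (hP : ∀ s s', 0 ≤ P s s') (hP1 : ∀ s, ∑ s', P s s' = 1)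
    (hβ : ∀ s, 0 ≤ β s) (hβ1 : ∑ s, β s = 1) (t : ℕ) (s : S) : marginal P β t s ≤ 1 := by
  rw [← sum_marginal hP1 hβ1 t]
  exact single_le_sum (fun u _ => marginal_nonneg hP hβ t u) (mem_univ s)

variable [DecidableEq S] {R : Finset S} {w : S → ℝ}

/-- Expected numbers of visits outside a closed set `R` are bounded by any supersolution `w` of the
balance equations there. -/
theorem sum_range_marginal_le (hP : ∀ s s', 0 ≤ P s s')
    (hR : ∀ s ∈ R, ∀ s' ∉ R, P s s' = 0) (hw : ∀ f ∉ R, 0 ≤ w f)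
    (hbal : ∀ f ∉ R, β f + ∑ s ∈ Rᶜ, w s * P s f ≤ w f) (n : ℕ) {f : S} (hf : f ∉ R) :
    ∑ t ∈ range n, marginal P β t f ≤ w f := by
  induction n generalizing f with
  | zero => simpa using hw f hf
  | succ n ih =>
    -- Time 0 is split off: visits at times `1, …, n` are one-step images of visits at times `0, …,
    -- n - 1`.
    rw [sum_range_succ']
    have h1 : ∑ t ∈ range n, marginal P β (t + 1) f =
        ∑ s ∈ Rᶜ, (∑ t ∈ range n, marginal P β t s) * P s f := by
      simp only [marginal, sum_mul]
      rw [sum_comm, ← sum_compl_add_sum R, add_eq_left]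
      exact sum_eq_zero fun s hs => sum_eq_zero fun t _ => by rw [hR s hs f hf, mul_zero]
    have h2 : ∑ s ∈ Rᶜ, (∑ t ∈ range n, marginal P β t s) * P s f ≤ ∑ s ∈ Rᶜ, w s * P s f :=
      sum_le_sum fun s hs => mul_le_mul_of_nonneg_right (ih (mem_compl.1 hs)) (hP s f)
    have h3 := hbal f hf
    simp only [marginal] at h1 ⊢
    linarith

/-- The mass of a closed part `B` of `R` is what started there plus what entered it from outside
`R`. -/
theorem sum_marginal_closed (hP1 : ∀ s, ∑ s', P s s' = 1) {B : Finset S} (hBR : B ⊆ R)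
    (hB : ∀ s ∈ B, ∀ s' ∉ B, P s s' = 0) (hRB : ∀ s ∈ R \ B, ∀ s' ∈ B, P s s' = 0) (n : ℕ) :
    ∑ s ∈ B, marginal P β n s = ∑ s ∈ B, β s +
      ∑ s ∈ Rᶜ, (∑ t ∈ range n, marginal P β t s) * ∑ s' ∈ B, P s s' := by
  induction n with
  | zero => simp [marginal]
  | succ n ih =>
    have h1 : ∑ s' ∈ B, marginal P β (n + 1) s' = ∑ s, marginal P β n s * ∑ s' ∈ B, P s s' := by
      simp only [marginal, mul_sum]
      exact sum_comm
    have h2 : ∀ s ∈ B, ∑ s' ∈ B, P s s' = 1 := by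
      intro s hs
      rw [← hP1 s]
      exact sum_subset (subset_univ _) fun s' _ hs' => hB s hs s' hs'
    have h3 : ∑ s ∈ R, marginal P β n s * ∑ s' ∈ B, P s s' = ∑ s ∈ B, marginal P β n s := by
      rw [← sum_sdiff hBR, sum_eq_zero, zero_add]
      · exact sum_congr rfl fun s hs => by rw [h2 s hs, mul_one]
      · exact fun s hs => by rw [sum_eq_zero (hRB s hs), mul_zero]
    rw [h1, ← sum_compl_add_sum R, h3, ih]
    simp only [sum_range_succ, add_mul, sum_add_distrib]
    ring

theorem sum_marginal_closed_le (hP : ∀ s s', 0 ≤ P s s') (hP1 : ∀ s, ∑ s', P s s' = 1)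
    (hR : ∀ s ∈ R, ∀ s' ∉ R, P s s' = 0) (hw : ∀ f ∉ R, 0 ≤ w f)
    (hbal : ∀ f ∉ R, β f + ∑ s ∈ Rᶜ, w s * P s f ≤ w f) {B : Finset S} (hBR : B ⊆ R)
    (hB : ∀ s ∈ B, ∀ s' ∉ B, P s s' = 0) (hRB : ∀ s ∈ R \ B, ∀ s' ∈ B, P s s' = 0) (n : ℕ) :
    ∑ s ∈ B, marginal P β n s ≤ ∑ s ∈ B, β s + ∑ s ∈ Rᶜ, w s * ∑ s' ∈ B, P s s' := by
  rw [sum_marginal_closed hP1 hBR hB hRB]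
  gcongr with s hs
  · exact sum_nonneg fun s' _ => hP s s'
  · exact sum_range_marginal_le hP hR hw hbal n (mem_compl.1 hs)

end Stochastic

/-! ### Cesàro averages of the marginals -/

section Cesaro

variable {S : Type*} [Fintype S] {P : S → S → ℝ} {β : S → ℝ}

/-- The average of the distributions at times `1, …, n`. -/
noncomputable def cesaro (P : S → S → ℝ) (β : S → ℝ) (n : ℕ) (s : S) : ℝ :=
  (1 / (n : ℝ)) * ∑ t ∈ Icc 1 n, marginal P β t s

theorem sum_cesaro (B : Finset S) (n : ℕ) :
    ∑ s ∈ B, cesaro P β n s = (1 / (n : ℝ)) * ∑ t ∈ Icc 1 n, ∑ s ∈ B, marginal P β t s := by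
  simp only [cesaro]
  rw [← mul_sum, sum_comm]

theorem average_le {u : ℕ → ℝ} {c : ℝ} (hc : 0 ≤ c) (hu : ∀ t, u t ≤ c) (n : ℕ) :
    (1 / (n : ℝ)) * ∑ t ∈ Icc 1 n, u t ≤ c := by
  -- The average for `n = 0` is `0`, since `1 / 0 = 0`; this case needs `hc`.
  rcases Nat.eq_zero_or_pos n with rfl | hn
  · simpa using hc
  · have hn' : (0 : ℝ) < n := by exact_mod_cast hn
    have h : ∑ t ∈ Icc 1 n, u t ≤ n * c := by
      simpa using sum_le_card_nsmul (Icc 1 n) u c fun t _ => hu t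
    rw [one_div, inv_mul_le_iff₀ hn']
    exact h

theorem cesaro_nonneg (hP : ∀ s s', 0 ≤ P s s') (hβ : ∀ s, 0 ≤ β s) (n : ℕ) (s : S) :
    0 ≤ cesaro P β n s :=
  mul_nonneg (by positivity) (sum_nonneg fun t _ => marginal_nonneg hP hβ t s)

/-- The sum telescopes, so the defect from stationarity is `O(1/n)` and vanishes at cluster points.
-/
theorem cesaro_step (n : ℕ) (s' : S) :
    ∑ s, cesaro P β n s * P s s' - cesaro P β n s' =
      (1 / (n : ℝ)) * (marginal P β (n + 1) s' - marginal P β 1 s') := by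
  have h1 : ∑ s, cesaro P β n s * P s s' =
      (1 / (n : ℝ)) * ∑ t ∈ Icc 1 n, marginal P β (t + 1) s' := by
    simp only [cesaro, marginal, mul_assoc, sum_mul]
    rw [← mul_sum, sum_comm]
  have h2 : ∑ t ∈ Icc 1 n, (marginal P β (t + 1) s' - marginal P β t s') =
      marginal P β (n + 1) s' - marginal P β 1 s' := by
    rw [← Ico_add_one_right_eq_Icc, sum_Ico_sub (fun t => marginal P β t s') (by omega)]
  rw [h1, cesaro, ← mul_sub, ← sum_sub_distrib, h2]

theorem tendsto_one_div_mul_of_bounded {u : ℕ → ℝ} {c : ℝ} (hu : ∀ n, |u n| ≤ c) :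
    Tendsto (fun n : ℕ => (1 / (n : ℝ)) * u n) atTop (𝓝 0) :=
  tendsto_one_div_atTop_nhds_zero_nat.zero_mul_isBoundedUnder_le
    (isBoundedUnder_of ⟨c, fun n => by simpa using hu n⟩)

/-- If the expected numbers of visits outside a closed set `R` are bounded, and a stationary
distribution `x` on `R` has the right mass on every unichain closed part of `R`, then the Cesàro
averages of the marginals converge to `x`. -/
theorem tendsto_cesaro (hP : ∀ s s', 0 ≤ P s s') (hP1 : ∀ s, ∑ s', P s s' = 1)
    (hβ : ∀ s, 0 ≤ β s) (hβ1 : ∑ s, β s = 1) {x w : S → ℝ} {R : Set S}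
    (hx : ∀ s, 0 ≤ x s) (hx1 : ∑ s, x s = 1) (hxR : ∀ s ∉ R, x s = 0)
    (hstat : ∀ s', ∑ s, x s * P s s' = x s')
    (hvisit : ∀ n, ∀ f ∉ R, ∑ t ∈ range n, marginal P β t f ≤ w f)
    (hcover : ∀ s ∈ R, ∃ C : Finset S, s ∈ C ∧ (∀ u ∈ C, ∀ v, 0 < P u v → v ∈ C) ∧
      (∃! D, IsClosedClass (fun s s' => 0 < P s s') D ∧ D ⊆ (C : Set S)) ∧
      (∀ n, ∑ s ∈ C, marginal P β n s ≤ ∑ s ∈ C, x s) ∧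
      ∃ C' : Finset S, (∀ s ∈ R, s ∉ C → s ∈ C') ∧ Disjoint C C' ∧
      (∀ n, ∑ s ∈ C', marginal P β n s ≤ ∑ s ∈ C', x s)) :
    Tendsto (cesaro P β) atTop (𝓝 x) := by
  classical
  refine (isCompact_Icc (a := (0 : S → ℝ)) (b := 1)).tendsto_nhds_of_unique_mapClusterPt
    (Eventually.of_forall fun n => ⟨fun s => cesaro_nonneg hP hβ n s, fun s =>
      average_le zero_le_one (fun t => marginal_le_one hP hP1 hβ hβ1 t s) n⟩) ?_
  intro μ _ hμ
  obtain ⟨ψ, hψ, hlim⟩ := hμ.tendsto_subseq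
  have hψ' := hψ.tendsto_atTop
  have hcoord : ∀ s, Tendsto (fun n => cesaro P β (ψ n) s) atTop (𝓝 (μ s)) := fun s =>
    tendsto_pi_nhds.1 hlim s
  have hsumlim : ∀ B : Finset S, Tendsto (fun n => ∑ s ∈ B, cesaro P β (ψ n) s) atTop
      (𝓝 (∑ s ∈ B, μ s)) := fun B => tendsto_finsetSum _ fun s _ => hcoord s
  have hμstat : ∀ s', ∑ s, μ s * P s s' = μ s' := by
    intro s'
    have h1 : Tendsto (fun n => ∑ s, cesaro P β (ψ n) s * P s s' - cesaro P β (ψ n) s') atTop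
        (𝓝 (∑ s, μ s * P s s' - μ s')) :=
      (tendsto_finsetSum _ fun s _ => (hcoord s).mul_const _).sub (hcoord s')
    have h2 : Tendsto (fun n => ∑ s, cesaro P β n s * P s s' - cesaro P β n s') atTop (𝓝 0) := by
      simp only [cesaro_step]
      refine tendsto_one_div_mul_of_bounded (c := 1) fun n => abs_sub_le_iff.2 ?_
      have := marginal_nonneg hP hβ (n + 1) s'
      have := marginal_nonneg hP hβ 1 s'
      have := marginal_le_one hP hP1 hβ hβ1 (n + 1) s'
      have := marginal_le_one hP hP1 hβ hβ1 1 s'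
      constructor <;> linarith
    exact sub_eq_zero.1 (tendsto_nhds_unique h1 (h2.comp hψ'))
  have hμR : ∀ f ∉ R, μ f = 0 := by
    intro f hf
    have h2 : Tendsto (fun n => cesaro P β n f) atTop (𝓝 0) := by
      refine tendsto_one_div_mul_of_bounded (c := w f) fun n => ?_
      rw [abs_of_nonneg (sum_nonneg fun t _ => marginal_nonneg hP hβ t f)]
      refine le_trans (sum_le_sum_of_subset_of_nonneg (t := range (n + 1)) ?_ ?_)
        (hvisit (n + 1) f hf)
      · intro t ht
        simp only [mem_Icc] at ht
        simp only [mem_range]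
        omega
      · exact fun t _ _ => marginal_nonneg hP hβ t f
    exact tendsto_nhds_unique (hcoord f) (h2.comp hψ')
  have hμ1 : ∑ s, μ s = 1 := by
    refine tendsto_nhds_unique (hsumlim univ) (tendsto_const_nhds.congr' ?_)
    filter_upwards [hψ'.eventually (eventually_ge_atTop 1)] with n hn
    have hn' : ((ψ n : ℕ) : ℝ) ≠ 0 := by
      have : 0 < ψ n := hn
      positivity
    rw [sum_cesaro]
    simp [sum_marginal hP1 hβ1, hn']
  have hle : ∀ B : Finset S, (∀ n, ∑ s ∈ B, marginal P β n s ≤ ∑ s ∈ B, x s) →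
      ∑ s ∈ B, μ s ≤ ∑ s ∈ B, x s := fun B hB =>
    le_of_tendsto' (hsumlim B) fun n => by
      rw [sum_cesaro]
      exact average_le (sum_nonneg fun s _ => hx s) hB _
  funext s
  by_cases hs : s ∈ R
  · obtain ⟨C, hsC, hCcl, huni, hCle, C', hC', hdisj, hCle'⟩ := hcover s hs
    have hsplit : ∀ d : S → ℝ, (∀ s ∉ R, d s = 0) → ∑ s, d s = ∑ s ∈ C, d s + ∑ s ∈ C', d s := by
      intro d hd
      rw [← sum_union hdisj]
      refine (sum_subset (subset_univ _) fun t _ ht => hd t fun htR => ht ?_).symm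
      by_cases htC : t ∈ C
      · exact mem_union_left _ htC
      · exact mem_union_right _ (hC' t htR htC)
    have h1 := hsplit x hxR
    have h2 := hsplit μ hμR
    have h3 := hle C hCle
    have h4 := hle C' hCle'
    -- `μ` and `x` both have total mass one on `C ∪ C'`, so the two upper bounds `h3` and `h4` are
    -- equalities.
    have h0 : ∑ s ∈ C, (μ s - x s) = 0 := by
      rw [sum_sub_distrib]
      linarith
    refine sub_eq_zero.1 (eq_zero_of_stationary_of_unichain (d := fun s => μ s - x s) hP hP1 ?_
      hCcl huni h0 hsC)
    intro s'
    simp only [sub_mul, sum_sub_distrib, hμstat, hstat]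
  · rw [hxR s hs, hμR s hs]

end Cesaro

/-! ### The chain induced by a policy -/

variable {S A : Type*} [Fintype S] {M : MDP S A}

namespace MDP

theorem T_eq_zero_of_not_edge {s s' : S} (h : ¬ M.Edge s s') {a : A} (ha : a ∈ M.avail s) :
    M.T s a s' = 0 :=
  le_antisymm (not_lt.1 fun hpos => h ⟨a, ha, hpos⟩) (M.T_nonneg s a ha s')

end MDP

namespace Policy

variable (π : Policy M)

theorem trans_nonneg (s s' : S) : 0 ≤ π.trans s s' :=
  sum_nonneg fun a ha => mul_nonneg (M.T_nonneg s a ha s') (π.nonneg s a)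

theorem sum_trans (s : S) : ∑ s', π.trans s s' = 1 := by
  simp only [trans]
  rw [sum_comm, ← π.sum_eq_one s]
  exact sum_congr rfl fun a ha => by rw [← sum_mul, M.T_sum s a ha, one_mul]

theorem trans_eq_zero_of_not_edge {s s' : S} (h : ¬ M.Edge s s') : π.trans s s' = 0 :=
  sum_eq_zero fun a ha => by rw [MDP.T_eq_zero_of_not_edge h ha, zero_mul]

theorem edge_of_trans_pos {s s' : S} (h : 0 < π.trans s s') : M.Edge s s' := by
  by_contra hE
  exact h.ne' (π.trans_eq_zero_of_not_edge hE)

theorem trajProb_snoc (t : ℕ) (h : Fin (t + 1) → S × A) (p : S × A) :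
    π.trajProb (t + 1) (Fin.snoc (α := fun _ => S × A) h p) =
      π.trajProb t h * M.T (h (Fin.last t)).1 (h (Fin.last t)).2 p.1 * π.prob p.1 p.2 := by
  have h0 : (Fin.snoc (α := fun _ => S × A) h p : Fin (t + 2) → S × A) 0 = h 0 := by
    rw [← Fin.castSucc_zero, Fin.snoc_castSucc]
  simp only [trajProb, h0]
  rw [Fin.prod_univ_castSucc (n := t + 1), Fin.prod_univ_castSucc (n := t)
    (fun i : Fin (t + 1) => M.T _ _ _)]
  simp only [Fin.snoc_castSucc, Fin.snoc_last, Fin.succ_last, Fin.succ_castSucc]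
  ring

variable [Fintype A]

theorem stateActionProb_succ (t : ℕ) (s' : S) (a' : A) :
    π.stateActionProb (t + 1) s' a' =
      ∑ s, ∑ a, π.stateActionProb t s a * M.T s a s' * π.prob s' a' := by
  classical
  have h1 : π.stateActionProb (t + 1) s' a' = ∑ h : Fin (t + 1) → S × A,
      π.trajProb t h * M.T (h (Fin.last t)).1 (h (Fin.last t)).2 s' * π.prob s' a' := by
    simp only [stateActionProb, sum_filter]
    rw [← (Fin.snocEquiv fun _ : Fin (t + 2) => S × A).sum_comp, Fintype.sum_prod_type, sum_comm]
    refine sum_congr rfl fun h _ => ?_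
    rw [sum_eq_single (s', a')]
    · simp [Fin.snocEquiv, trajProb_snoc]
    · intro p _ hp
      simp [Fin.snocEquiv, hp]
    · simp
  rw [h1, ← Fintype.sum_prod_type' fun s a =>
    π.stateActionProb t s a * M.T s a s' * π.prob s' a',
    -- Trajectories are grouped by their last state-action pair.
    ← sum_fiberwise univ fun h : Fin (t + 1) → S × A => h (Fin.last t)]
  refine sum_congr rfl fun p _ => ?_
  simp only [stateActionProb, sum_mul]
  refine sum_congr (by ext; simp) fun h hh => ?_
  rw [(mem_filter.1 hh).2]

/-- Given the current state, the action is independent of the past; this reduces the theorem to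
state marginals. -/
theorem stateActionProb_eq (t : ℕ) (s : S) (a : A) :
    π.stateActionProb t s a = marginal π.trans M.β t s * π.prob s a := by
  classical
  induction t generalizing s a with
  | zero =>
    simp only [stateActionProb, sum_filter]
    rw [← (Equiv.funUnique (Fin 1) (S × A)).symm.sum_comp, sum_eq_single (s, a)]
    · simp [trajProb, marginal, Equiv.funUnique]
    · intro p _ hp
      simp [Equiv.funUnique, hp]
    · simp
  | succ t ih =>
    rw [stateActionProb_succ]
    simp only [marginal, sum_mul, ih, trans, mul_sum]
    refine sum_congr rfl fun u _ => ?_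
    rw [← sum_subset (subset_univ (M.avail u))]
    · exact sum_congr rfl fun b _ => by ring
    · intro b _ hb
      rw [π.eq_zero u b hb]
      ring

end Policy

/-! ### Policies derived from feasible points -/

section Derived

variable {x y : S → A → ℝ} {π : Policy M}

theorem MDP.Feasible.sum_eq_zero_of_not_mem (hxy : M.Feasible x y) {f : S}
    (hf : f ∉ M.recurrentSet) : ∑ a ∈ M.avail f, x f a = 0 :=
  (sum_eq_zero_iff_of_nonneg fun s _ => sum_nonneg (hxy.x_nonneg s)).1 hxy.transient f
    (by simp [hf])

/-- If `x_s = 0`, each `x s a` vanishes by nonnegativity, so the choice of `π` there is harmless. -/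
theorem Policy.IsDerivedFrom.x_mul_prob (hπ : π.IsDerivedFrom x y) (hxy : M.Feasible x y)
    (s : S) {a : A} (ha : a ∈ M.avail s) :
    (∑ b ∈ M.avail s, x s b) * π.prob s a = x s a := by
  rcases (sum_nonneg (hxy.x_nonneg s)).eq_or_lt with h | h
  · rw [← h, zero_mul, (sum_eq_zero_iff_of_nonneg (hxy.x_nonneg s)).1 h.symm a ha]
  · rw [hπ.of_x s h a ha, mul_div_cancel₀ _ h.ne']

theorem Policy.IsDerivedFrom.y_mul_prob (hπ : π.IsDerivedFrom x y) (hxy : M.Feasible x y)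
    {s : S} (hs : s ∉ M.recurrentSet) {a : A} (ha : a ∈ M.avail s) :
    (∑ b ∈ M.avail s, y s b) * π.prob s a = y s a := by
  rcases (sum_nonneg (hxy.y_nonneg s)).eq_or_lt with h | h
  · rw [← h, zero_mul, (sum_eq_zero_iff_of_nonneg (hxy.y_nonneg s)).1 h.symm a ha]
  · rw [hπ.of_y s (hxy.sum_eq_zero_of_not_mem hs).not_gt h a ha, mul_div_cancel₀ _ h.ne']

theorem Policy.IsDerivedFrom.x_mul_trans (hπ : π.IsDerivedFrom x y) (hxy : M.Feasible x y)
    (s s' : S) :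
    (∑ b ∈ M.avail s, x s b) * π.trans s s' = ∑ a ∈ M.avail s, x s a * M.T s a s' := by
  rw [Policy.trans, mul_sum]
  refine sum_congr rfl fun a ha => ?_
  rw [← hπ.x_mul_prob hxy s ha]
  ring

theorem Policy.IsDerivedFrom.y_mul_trans (hπ : π.IsDerivedFrom x y) (hxy : M.Feasible x y)
    {s : S} (hs : s ∉ M.recurrentSet) (s' : S) :
    (∑ b ∈ M.avail s, y s b) * π.trans s s' = ∑ a ∈ M.avail s, y s a * M.T s a s' := by
  rw [Policy.trans, mul_sum]
  refine sum_congr rfl fun a ha => ?_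
  rw [← hπ.y_mul_prob hxy hs ha]
  ring

/-- Summed over all states, the `y`-flow cancels in the balance equations, leaving the mass of `β`.
-/
theorem MDP.Feasible.sum_x (hxy : M.Feasible x y) : ∑ s, ∑ a ∈ M.avail s, x s a = 1 := by
  have h := sum_congr (rfl : (univ : Finset S) = univ) fun s' _ => hxy.balance s'
  have hl : ∑ s', ∑ s, ∑ a ∈ M.avail s, y s a * M.T s a s' = ∑ s, ∑ a ∈ M.avail s, y s a := by
    rw [sum_comm]
    refine sum_congr rfl fun s _ => ?_
    rw [sum_comm]
    exact sum_congr rfl fun a ha => by rw [← mul_sum, M.T_sum s a ha, mul_one]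
  rw [hl] at h
  simp only [sum_add_distrib, sum_sub_distrib, M.β_sum] at h
  linarith

/-- The mass `x` gives to a closed part `B` of the recurrent set without inflow from the rest of
that set is the mass that starts in `B` plus the `y`-flow into `B`. -/
theorem Policy.IsDerivedFrom.sum_x_closed [DecidableEq S] (hπ : π.IsDerivedFrom x y)
    (hxy : M.Feasible x y)
    {R B : Finset S} (hR : ∀ s, s ∈ R ↔ s ∈ M.recurrentSet) (hBR : B ⊆ R)
    (hB : ∀ s ∈ B, ∀ s' ∉ B, ¬ M.Edge s s') (hRB : ∀ s ∈ R \ B, ∀ s' ∈ B, ¬ M.Edge s s') :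
    ∑ s ∈ B, M.β s + ∑ s ∈ Rᶜ, (∑ a ∈ M.avail s, y s a) * ∑ s' ∈ B, π.trans s s' =
      ∑ s ∈ B, ∑ a ∈ M.avail s, x s a := by
  -- Balance is summed over `B`: flow inside `B` cancels against `y` on `B`, and only inflow from
  -- outside `R` survives.
  have h := sum_congr (rfl : B = B) fun s' _ => hxy.balance s'
  rw [sum_comm, ← sum_compl_add_sum R, ← sum_sdiff hBR] at h
  have h1 : ∑ s ∈ R \ B, ∑ s' ∈ B, ∑ a ∈ M.avail s, y s a * M.T s a s' = 0 :=
    sum_eq_zero fun s hs => sum_eq_zero fun s' hs' => sum_eq_zero fun a ha => by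
      rw [MDP.T_eq_zero_of_not_edge (hRB s hs s' hs') ha, mul_zero]
  have h2 : ∑ s ∈ B, ∑ s' ∈ B, ∑ a ∈ M.avail s, y s a * M.T s a s' =
      ∑ s ∈ B, ∑ a ∈ M.avail s, y s a := by
    refine sum_congr rfl fun s hs => ?_
    rw [sum_comm]
    refine sum_congr rfl fun a ha => ?_
    rw [← mul_sum, sum_subset (subset_univ B), M.T_sum s a ha, mul_one]
    exact fun s' _ hs' => MDP.T_eq_zero_of_not_edge (hB s hs s' hs') ha
  have h3 : ∑ s ∈ Rᶜ, ∑ s' ∈ B, ∑ a ∈ M.avail s, y s a * M.T s a s' =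
      ∑ s ∈ Rᶜ, (∑ a ∈ M.avail s, y s a) * ∑ s' ∈ B, π.trans s s' := by
    refine sum_congr rfl fun s hs => ?_
    rw [mul_sum]
    refine sum_congr rfl fun s' _ => (hπ.y_mul_trans hxy ?_ s').symm
    exact fun hmem => mem_compl.1 hs ((hR s).2 hmem)
  rw [h1, h2, h3] at h
  simp only [sum_add_distrib, sum_sub_distrib] at h
  linarith

theorem Policy.IsDerivedFrom.tendsto_cesaro (hπ : π.IsDerivedFrom x y) (hxy : M.Feasible x y)
    (hcpu : π.IsCPU) :
    Tendsto (cesaro π.trans M.β) atTop (𝓝 fun s => ∑ a ∈ M.avail s, x s a) := by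
  classical
  set R : Finset S := univ.filter (· ∈ M.recurrentSet) with hRdef
  have hR : ∀ s, s ∈ R ↔ s ∈ M.recurrentSet := fun s => by simp [hRdef]
  have hRcl : ∀ s ∈ R, ∀ s' ∉ R, ¬ M.Edge s s' := by
    intro s hs s' hs' hE
    obtain ⟨C, hC, hsC⟩ := (hR s).1 hs
    exact hs' ((hR s').2 ⟨C, hC, hC.1.2 s hsC s' hE⟩)
  have hRP : ∀ s ∈ R, ∀ s' ∉ R, π.trans s s' = 0 := fun s hs s' hs' =>
    π.trans_eq_zero_of_not_edge (hRcl s hs s' hs')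
  have hw : ∀ f ∉ R, 0 ≤ ∑ a ∈ M.avail f, y f a := fun f _ => sum_nonneg (hxy.y_nonneg f)
  have hbal : ∀ f ∉ R, M.β f + ∑ s ∈ Rᶜ, (∑ a ∈ M.avail s, y s a) * π.trans s f ≤
      ∑ a ∈ M.avail f, y f a := by
    intro f hf
    have h := hxy.balance f
    rw [sum_add_distrib, hxy.sum_eq_zero_of_not_mem fun hmem => hf ((hR f).2 hmem),
      ← sum_compl_add_sum R] at h
    -- The inflow from `R` is in fact zero; its sign suffices for a supersolution.
    have h1 : 0 ≤ ∑ s ∈ R, ∑ a ∈ M.avail s, y s a * M.T s a f :=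
      sum_nonneg fun s _ => sum_nonneg fun a ha =>
        mul_nonneg (hxy.y_nonneg s a ha) (M.T_nonneg s a ha f)
    have h2 : ∑ s ∈ Rᶜ, (∑ a ∈ M.avail s, y s a) * π.trans s f =
        ∑ s ∈ Rᶜ, ∑ a ∈ M.avail s, y s a * M.T s a f :=
      sum_congr rfl fun s hs => hπ.y_mul_trans hxy
        (fun hmem => mem_compl.1 hs ((hR s).2 hmem)) f
    linarith
  have hmass : ∀ B ⊆ R, (∀ s ∈ B, ∀ s' ∉ B, ¬ M.Edge s s') →
      (∀ s ∈ R \ B, ∀ s' ∈ B, ¬ M.Edge s s') → ∀ n,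
      ∑ s ∈ B, marginal π.trans M.β n s ≤ ∑ s ∈ B, ∑ a ∈ M.avail s, x s a := by
    intro B hBR hB hRB n
    rw [← hπ.sum_x_closed hxy hR hBR hB hRB]
    exact sum_marginal_closed_le π.trans_nonneg π.sum_trans hRP hw hbal hBR
      (fun s hs s' hs' => π.trans_eq_zero_of_not_edge (hB s hs s' hs'))
      (fun s hs s' hs' => π.trans_eq_zero_of_not_edge (hRB s hs s' hs')) n
  refine SteadyState.tendsto_cesaro π.trans_nonneg π.sum_trans M.β_nonneg M.β_sum
    (w := fun s => ∑ a ∈ M.avail s, y s a) (R := M.recurrentSet)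
    (fun s => sum_nonneg (hxy.x_nonneg s)) hxy.sum_x
    (fun s hs => hxy.sum_eq_zero_of_not_mem hs) ?_ ?_ ?_
  · intro s'
    rw [← hxy.stationary s']
    exact sum_congr rfl fun s _ => hπ.x_mul_trans hxy s s'
  · exact fun n f hf => sum_range_marginal_le π.trans_nonneg hRP hw hbal n
      fun hmem => hf ((hR f).1 hmem)
  · rintro s ⟨C, hC, hsC⟩
    set B : Finset S := univ.filter (· ∈ C) with hBdef
    have hBC : ∀ u, u ∈ B ↔ u ∈ C := fun u => by simp [hBdef]
    have hBcoe : (B : Set S) = C := Set.ext hBC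
    have hBR : B ⊆ R := fun u hu => (hR u).2 ⟨C, hC, (hBC u).1 hu⟩
    have hBcl : ∀ u ∈ B, ∀ v, M.Edge u v → v ∈ B := fun u hu v huv =>
      (hBC v).2 (hC.1.2 u ((hBC u).1 hu) v huv)
    have hdiff : ∀ u ∈ R \ B, ∀ v, M.Edge u v → v ∈ R \ B := by
      intro u hu v huv
      obtain ⟨huR, huB⟩ := mem_sdiff.1 hu
      obtain ⟨hv, hvC⟩ := tsccUnion_diff_closed hC ((hR u).1 huR)
        (fun h => huB ((hBC u).2 h)) huv
      exact mem_sdiff.2 ⟨(hR v).2 hv, fun h => hvC ((hBC v).1 h)⟩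
    refine ⟨B, (hBC s).2 hsC, fun u hu v huv => hBcl u hu v (π.edge_of_trans_pos huv), ?_, ?_,
      R \ B, fun u hu huB => mem_sdiff.2 ⟨(hR u).2 hu, huB⟩, disjoint_sdiff, ?_⟩
    · rw [hBcoe]
      exact hcpu.unichain C hC
    · exact hmass B hBR (fun u hu v hv huv => hv (hBcl u hu v huv))
        fun u hu v hv huv => (mem_sdiff.1 (hdiff u hu v huv)).2 hv
    -- The other TSCCs together are closed too, so the mass bound applies with `B` and `R \ B`
    -- exchanged.
    · refine hmass (R \ B) sdiff_subset (fun u hu v hv huv => hv (hdiff u hu v huv)) ?_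
      intro u hu v hv huv
      rw [Finset.sdiff_sdiff_eq_self hBR] at hu
      exact (mem_sdiff.1 hv).2 (hBcl u hu v huv)

end Derived

end SteadyState

theorem mainTheorem3 {S A : Type*} [Fintype S] [Fintype A] (M : SteadyState.MDP S A)
    (x y : S → A → ℝ) (hxy : M.Feasible x y)
    (π : SteadyState.Policy M) (hπ : π.IsDerivedFrom x y) (hcpu : π.IsCPU) :
    π.HasSteadyStateDistribution x := by
  intro s a ha
  have h := (tendsto_pi_nhds.1 (hπ.tendsto_cesaro hxy hcpu) s).mul_const (π.prob s a)
  rw [hπ.x_mul_prob hxy s ha] at h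
  refine h.congr fun n => ?_
  simp only [SteadyState.cesaro, π.stateActionProb_eq, ← Finset.sum_mul, mul_assoc]
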